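/- For complex numbers $A,q$ and an integer $n\ge 0$ write $(A;q)_n=\prod_{k=0}^{n-1}(1-Aq^k)$ (so $(A;q)_0=1$) and $(A,B;q)_n=(A;q)_n(B;q)_n$. Let $a,x\in\mathbb{C}$ with $a\neq 0$ and $|x|<1$. Then both series below converge absolutely, and $$1+(a-1)\sum_{n=1}^{\infty}\frac{(-ax;x)_{n-1}\,(-1/a,x;x)_n\,x^{n(n+1)/2}(-1)^n}{(x;x)_{2n}} =\sum_{n=0}^{\infty}x^{n^2}(-1)^n\left(a^n+x^{2n+1}a^{-n-1}\right).$$ -/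

import Mathlib

/-- The finite rising `q`-factorial `(A; q)_n = (1 - A) (1 - A q) ⋯ (1 - A q ^ (n - 1))`,
with `(A; q)_0 = 1`. -/
def qFactorial (A q : ℂ) (n : ℕ) : ℂ :=
  ∏ k ∈ Finset.range n, (1 - A * q ^ k)

/-- The two-parameter rising `q`-factorial `(A, B; q)_n = (A; q)_n (B; q)_n`. -/
def qFactorial₂ (A B q : ℂ) (n : ℕ) : ℂ :=
  qFactorial A q n * qFactorial B q n

/-- The summand, for `n ≥ 1`,
`(-ax; x)_{n-1} (-1/a, x; x)_n x ^ (n(n+1)/2) (-1)^n / (x; x)_{2n}`. -/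
noncomputable def leftTerm (a x : ℂ) (n : ℕ+) : ℂ :=
  qFactorial (-a * x) x ((n : ℕ) - 1) * qFactorial₂ (-1 / a) x x (n : ℕ)
    * x ^ ((n : ℕ) * ((n : ℕ) + 1) / 2) * (-1) ^ (n : ℕ) / qFactorial x x (2 * (n : ℕ))

/-- The summand, for `n ≥ 0`, `x ^ (n^2) (-1)^n (a^n + x^(2n+1) a^(-n-1))`. -/
noncomputable def falseThetaTerm (a x : ℂ) (n : ℕ) : ℂ :=
  x ^ (n ^ 2) * (-1) ^ n * (a ^ n + x ^ (2 * n + 1) * a ^ (-(n : ℤ) - 1))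

open Filter Topology

/-! Write q for x. The `k = 0` factor of `(-1/a; q)_n` combines with `a - 1` to give `a - a⁻¹`, so
the n-th summand times `a - 1` is antisymmetric under `a ↔ a⁻¹`. A finite form of the Jacobi triple
product (`prod_eq_sum_thetaCoeff`) expands it in the functions `a ^ j - a⁻¹ ^ j`. Quadratic
exponents make the resulting double series absolutely summable, so the sums may be exchanged. For
fixed `j ≥ 1` the inner sum is a `₁φ₁` series in closed form, equal to `(-1)^j q^(j^2)`
(`hasSum_doubleCoeff`). Its evaluation `hasSum_phiTerm` is a telescoping argument of Wilf–Zeilberger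
type. What remains is `1 + ∑_{j ≥ 1} (-1)^j q^(j^2) (a^j - a^(-j))`, a regrouping of the false theta
series. -/

theorem qFactorial_succ (A q : ℂ) (n : ℕ) :
    qFactorial A q (n + 1) = qFactorial A q n * (1 - A * q ^ n) :=
  Finset.prod_range_succ _ _

theorem qFactorial_zero (A q : ℂ) : qFactorial A q 0 = 1 :=
  Finset.prod_range_zero _

theorem qFactorial_self_succ (q : ℂ) (n : ℕ) :
    qFactorial q q (n + 1) = qFactorial q q n * (1 - q ^ (n + 1)) := by
  rw [qFactorial_succ, pow_succ']

theorem one_sub_pow_succ_ne_zero {q : ℂ} (hq : ‖q‖ < 1) (n : ℕ) : 1 - q ^ (n + 1) ≠ 0 := by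
  intro h
  have h1 : ‖q ^ (n + 1)‖ < 1 := by
    rw [norm_pow]
    exact pow_lt_one₀ (norm_nonneg _) hq n.succ_ne_zero
  rw [← sub_eq_zero.1 h, norm_one] at h1
  exact lt_irrefl _ h1

theorem qFactorial_self_ne_zero {q : ℂ} (hq : ‖q‖ < 1) (n : ℕ) : qFactorial q q n ≠ 0 := by
  induction n with
  | zero => simp [qFactorial_zero]
  | succ n ih =>
    rw [qFactorial_self_succ]
    exact mul_ne_zero ih (one_sub_pow_succ_ne_zero hq n)

theorem choose_two_succ (n : ℕ) : (n + 1).choose 2 = n + n.choose 2 := by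
  rw [Nat.choose_succ_succ' n 1, Nat.choose_one_right]

/-! ### Bounds -/

theorem sum_range_pow_le {r : ℝ} (h0 : 0 ≤ r) (h1 : r < 1) (n : ℕ) :
    ∑ k ∈ Finset.range n, r ^ k ≤ (1 - r)⁻¹ := by
  rw [← tsum_geometric_of_lt_one h0 h1]
  exact (summable_geometric_of_lt_one h0 h1).sum_le_tsum _ fun i _ => pow_nonneg h0 i

theorem norm_qFactorial_le {q : ℂ} (hq : ‖q‖ < 1) (A : ℂ) (n : ℕ) :
    ‖qFactorial A q n‖ ≤ Real.exp (‖A‖ * (1 - ‖q‖)⁻¹) := by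
  have h : ‖qFactorial A q n‖ ≤ ∏ k ∈ Finset.range n, Real.exp (‖A‖ * ‖q‖ ^ k) := by
    rw [qFactorial, norm_prod]
    refine Finset.prod_le_prod (fun _ _ => norm_nonneg _) fun k _ => ?_
    calc ‖1 - A * q ^ k‖ ≤ ‖(1 : ℂ)‖ + ‖A * q ^ k‖ := norm_sub_le _ _
      _ = ‖A‖ * ‖q‖ ^ k + 1 := by rw [norm_one, norm_mul, norm_pow, add_comm]
      _ ≤ _ := Real.add_one_le_exp _
  refine h.trans ?_
  rw [← Real.exp_sum, ← Finset.mul_sum]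
  gcongr
  exact sum_range_pow_le (norm_nonneg _) hq n

/-- With `t = ‖q‖^(k+1)`, each inverse factor is at most `1/(1-t) = 1 + t/(1-t)`, hence at most an
exponential with geometrically decaying exponent. -/
theorem norm_inv_qFactorial_self_le {q : ℂ} (hq : ‖q‖ < 1) (n : ℕ) :
    ‖(qFactorial q q n)⁻¹‖ ≤ Real.exp ((1 - ‖q‖)⁻¹ * (1 - ‖q‖)⁻¹) := by
  have hr : 0 < 1 - ‖q‖ := sub_pos.2 hq
  have h : ‖(qFactorial q q n)⁻¹‖ ≤
      ∏ k ∈ Finset.range n, Real.exp ((1 - ‖q‖)⁻¹ * ‖q‖ ^ k) := by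
    rw [qFactorial, norm_inv, norm_prod, ← Finset.prod_inv_distrib]
    refine Finset.prod_le_prod (fun _ _ => by positivity) fun k _ => ?_
    have hk : ‖q‖ ^ (k + 1) ≤ ‖q‖ := pow_le_of_le_one (norm_nonneg _) hq.le k.succ_ne_zero
    have hk' : ‖q‖ ^ (k + 1) ≤ ‖q‖ ^ k :=
      pow_le_pow_of_le_one (norm_nonneg _) hq.le k.le_succ
    have hpos : 0 < 1 - ‖q‖ ^ (k + 1) := by linarith
    have h1 : 1 - ‖q‖ ^ (k + 1) ≤ ‖1 - q * q ^ k‖ := by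
      have := norm_sub_norm_le (1 : ℂ) (q ^ (k + 1))
      rwa [norm_one, norm_pow, pow_succ' q] at this
    calc ‖1 - q * q ^ k‖⁻¹ ≤ (1 - ‖q‖ ^ (k + 1))⁻¹ := inv_anti₀ hpos h1
      _ = (1 - ‖q‖ ^ (k + 1))⁻¹ * ‖q‖ ^ (k + 1) + 1 := by field_simp; ring
      _ ≤ (1 - ‖q‖)⁻¹ * ‖q‖ ^ k + 1 := by gcongr
      _ ≤ _ := Real.add_one_le_exp _
  refine h.trans ?_
  rw [← Real.exp_sum, ← Finset.mul_sum]
  gcongr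
  exact sum_range_pow_le (norm_nonneg _) hq n

theorem exists_bound_qFactorial_self {q : ℂ} (hq : ‖q‖ < 1) :
    ∃ M : ℝ, 0 ≤ M ∧ ∀ n, ‖qFactorial q q n‖ ≤ M ∧ ‖(qFactorial q q n)⁻¹‖ ≤ M :=
  ⟨_, le_trans (Real.exp_pos _).le (le_max_left _ _), fun n =>
    ⟨(norm_qFactorial_le hq q n).trans (le_max_left _ _),
      (norm_inv_qFactorial_self_le hq n).trans (le_max_right _ _)⟩⟩

/-- Consecutive terms have ratio `r^n |s| → 0`, so the quadratic exponent beats any geometric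
growth. -/
theorem summable_pow_choose_two_mul_pow {r : ℝ} (h0 : 0 ≤ r) (h1 : r < 1) (s : ℝ) :
    Summable fun n : ℕ => r ^ n.choose 2 * s ^ n := by
  refine summable_of_ratio_norm_eventually_le (r := 1 / 2) (by norm_num) ?_
  have ht : Tendsto (fun n : ℕ => r ^ n * |s|) atTop (𝓝 0) := by
    simpa using (tendsto_pow_atTop_nhds_zero_of_lt_one h0 h1).mul_const |s|
  filter_upwards [ht.eventually_le_const (show (0 : ℝ) < 1 / 2 by norm_num)] with n hn
  calc ‖r ^ (n + 1).choose 2 * s ^ (n + 1)‖ = (r ^ n * |s|) * ‖r ^ n.choose 2 * s ^ n‖ := by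
        rw [choose_two_succ, pow_add, pow_succ]
        simp only [norm_mul, norm_pow, Real.norm_eq_abs, abs_of_nonneg h0]
        ring
    _ ≤ 1 / 2 * ‖r ^ n.choose 2 * s ^ n‖ := by gcongr

theorem summable_pow_choose_succ_two {r : ℝ} (h0 : 0 ≤ r) (h1 : r < 1) :
    Summable fun n : ℕ => r ^ (n + 1).choose 2 := by
  simpa using (summable_nat_add_iff 1).2 (summable_pow_choose_two_mul_pow h0 h1 1)

/-! ### The finite expansion -/

/-- The coefficients in the expansion of
`(a - a⁻¹) ∏ k ∈ Icc 1 (n - 1), (1 + a q ^ k) (1 + q ^ k / a)`. -/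
noncomputable def thetaCoeff (q : ℂ) (n j : ℕ) : ℂ :=
  if j ≤ n then qFactorial q q (2 * n - 1) * (1 - q ^ j) * (1 + q ^ n) * q ^ j.choose 2
    / (qFactorial q q (n - j) * qFactorial q q (n + j)) else 0

theorem thetaCoeff_zero (q : ℂ) (n : ℕ) : thetaCoeff q n 0 = 0 := by
  simp [thetaCoeff]

theorem thetaCoeff_of_lt (q : ℂ) {n j : ℕ} (h : n < j) : thetaCoeff q n j = 0 :=
  if_neg h.not_ge

theorem thetaCoeff_add (q : ℂ) (k j : ℕ) : thetaCoeff q (k + j) j =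
    qFactorial q q (2 * (k + j) - 1) * (1 - q ^ j) * (1 + q ^ (k + j)) * q ^ j.choose 2
    / (qFactorial q q k * qFactorial q q (k + 2 * j)) := by
  rw [thetaCoeff, if_pos (Nat.le_add_left _ _), Nat.add_sub_cancel]
  congr 3
  ring

/-- This is the effect on coefficients of multiplying by `(1 + a q^n)(1 + q^n/a) = 1 + q^(2n) + q^n
(a + a⁻¹)`. -/
theorem thetaCoeff_succ_succ {q : ℂ} (hq : ‖q‖ < 1) {n : ℕ} (hn : 1 ≤ n) (j : ℕ) :
    thetaCoeff q (n + 1) (j + 1) = (1 + q ^ (2 * n)) * thetaCoeff q n (j + 1)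
      + q ^ n * (thetaCoeff q n j + thetaCoeff q n (j + 2)) := by
  have hp := qFactorial_self_ne_zero hq
  have ho := one_sub_pow_succ_ne_zero hq
  rcases lt_or_ge n j with h | h
  · rw [thetaCoeff_of_lt q (by omega), thetaCoeff_of_lt q (by omega), thetaCoeff_of_lt q h,
      thetaCoeff_of_lt q (by omega)]
    ring
  obtain ⟨k, rfl⟩ := Nat.exists_eq_add_of_le' h
  have hs : 2 * (k + (j + 1)) - 1 = 2 * (k + j) - 1 + 1 + 1 := by omega
  have hs' : 2 * (k + j) - 1 + 1 = 2 * (k + j) := by omega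
  have hd : k + 2 * (j + 1) = k + 2 * j + 1 + 1 := by ring
  have c1 : (j + 1).choose 2 = j + j.choose 2 := choose_two_succ j
  have c2 : (j + 2).choose 2 = j + 1 + (j + j.choose 2) := by rw [choose_two_succ, c1]
  have e0 : thetaCoeff q (k + j + 1) (j + 1) = qFactorial q q (2 * (k + j) - 1)
      * (1 - q ^ (2 * (k + j))) * (1 - q ^ (2 * (k + j) + 1)) * (1 - q ^ (j + 1))
      * (1 + q ^ (k + j + 1)) * q ^ (j + j.choose 2)
      / (qFactorial q q k * (qFactorial q q (k + 2 * j) * (1 - q ^ (k + 2 * j + 1))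
        * (1 - q ^ (k + 2 * j + 2)))) := by
    rw [add_assoc k j 1, thetaCoeff_add, hs, qFactorial_self_succ, qFactorial_self_succ, hs', hd,
      qFactorial_self_succ, qFactorial_self_succ, c1]
  -- The factor `1 - q^k` here, and `(1 - q^k)(q - q^k)` in `e2`, vanish exactly where the
  -- coefficient is cut off, so one formula covers the boundary cases.
  have e1 : thetaCoeff q (k + j) (j + 1) = qFactorial q q (2 * (k + j) - 1)
      * (1 - q ^ (j + 1)) * (1 + q ^ (k + j)) * q ^ (j + j.choose 2) * (1 - q ^ k)
      / (qFactorial q q k * (qFactorial q q (k + 2 * j) * (1 - q ^ (k + 2 * j + 1)))) := by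
    rcases k with _ | k
    · rw [thetaCoeff_of_lt q (by omega)]
      simp
    · have h1 : k + 1 + j = k + (j + 1) := by ring
      have h2 : k + 2 * (j + 1) = k + 1 + 2 * j + 1 := by ring
      rw [h1, thetaCoeff_add, h2, qFactorial_self_succ q (k + 1 + 2 * j),
        qFactorial_self_succ q k, c1]
      have := hp k
      have := hp (k + 1 + 2 * j)
      have := ho k
      have := ho (k + 1 + 2 * j)
      field_simp
  have e2 : thetaCoeff q (k + j) (j + 2) = qFactorial q q (2 * (k + j) - 1)
      * (1 - q ^ (j + 2)) * (1 + q ^ (k + j)) * q ^ (j + (j + j.choose 2))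
      * (1 - q ^ k) * (q - q ^ k)
      / (qFactorial q q k * (qFactorial q q (k + 2 * j) * (1 - q ^ (k + 2 * j + 1))
        * (1 - q ^ (k + 2 * j + 2)))) := by
    rcases k with _ | _ | k
    · rw [thetaCoeff_of_lt q (by omega)]
      simp
    · rw [thetaCoeff_of_lt q (by omega)]
      simp
    · have h1 : k + 1 + 1 + j = k + (j + 2) := by ring
      have h2 : k + 2 * (j + 2) = k + 1 + 1 + 2 * j + 1 + 1 := by ring
      rw [h1, thetaCoeff_add, h2, qFactorial_self_succ q (k + 1 + 1 + 2 * j + 1),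
        qFactorial_self_succ q (k + 1 + 1 + 2 * j),
        qFactorial_self_succ q (k + 1), qFactorial_self_succ q k, c2]
      have := hp k
      have := hp (k + 1 + 1 + 2 * j)
      have := ho k
      have := ho (k + 1)
      have := ho (k + 1 + 1 + 2 * j)
      have := ho (k + 1 + 1 + 2 * j + 1)
      field_simp
      ring
  rw [e0, e1, e2, thetaCoeff_add]
  have := hp k
  have := hp (k + 2 * j)
  have : 1 - q ^ (k + 2 * j + 1) ≠ 0 := ho _
  have : 1 - q ^ (k + 2 * j + 2) ≠ 0 := ho _
  generalize qFactorial q q (2 * (k + j) - 1) = S at *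
  generalize qFactorial q q k = S at *
  generalize qFactorial q q (k + 2 * j) = S at *
  generalize j.choose 2 = c at *
  simp only [pow_add, pow_mul', pow_one] at *
  generalize q ^ k = X at *
  generalize q ^ j = Y at *
  generalize q ^ c = Z at *
  field_simp
  ring

/-- Coefficients beyond `m + 1` vanish, so the range `N` is left free: index shifts in the induction
then cost no boundary terms. -/
theorem prod_eq_sum_thetaCoeff {q a : ℂ} (hq : ‖q‖ < 1) (ha : a ≠ 0) (m : ℕ) :
    ∀ N, m + 1 < N → (a - a⁻¹) * (qFactorial (-a * q) q m * qFactorial (-a⁻¹ * q) q m) =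
      ∑ j ∈ Finset.range N, thetaCoeff q (m + 1) j * (a ^ j - a⁻¹ ^ j) := by
  induction m with
  | zero =>
    intro N hN
    obtain ⟨N, rfl⟩ := Nat.exists_eq_add_of_le' hN
    rw [← Finset.sum_subset (s₁ := Finset.range 2) (Finset.range_mono (by omega))
      fun j _ hj => by
        rw [thetaCoeff_of_lt q (by simpa [Nat.lt_iff_add_one_le] using hj), zero_mul]]
    have h1 := one_sub_pow_succ_ne_zero hq 0
    have h2 : 1 - q ^ 2 ≠ 0 := one_sub_pow_succ_ne_zero hq 1
    simp only [Finset.sum_range_succ, Finset.sum_range_zero, thetaCoeff_zero, qFactorial_zero]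
    simp only [thetaCoeff, qFactorial, Finset.prod_range_succ, Finset.prod_range_zero] at h1 ⊢
    norm_num at h1 ⊢
    field_simp
    ring
  | succ m ih =>
    intro N hN
    obtain ⟨N, rfl⟩ := Nat.exists_eq_add_of_le' (show 1 ≤ N by omega)
    set F := (a - a⁻¹) * (qFactorial (-a * q) q m * qFactorial (-a⁻¹ * q) q m) with hF
    have hL : (a - a⁻¹) * (qFactorial (-a * q) q (m + 1) * qFactorial (-a⁻¹ * q) q (m + 1)) =
        (1 + q ^ (2 * (m + 1)) + q ^ (m + 1) * (a + a⁻¹)) * F := by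
      rw [qFactorial_succ, qFactorial_succ, hF]
      have : a * a⁻¹ = 1 := mul_inv_cancel₀ ha
      linear_combination ((a - a⁻¹) * (qFactorial (-a * q) q m * qFactorial (-a⁻¹ * q) q m))
        * (q * q ^ m) ^ 2 * this
    have s1 : F = ∑ j ∈ Finset.range N,
        thetaCoeff q (m + 1) (j + 1) * (a ^ (j + 1) - a⁻¹ ^ (j + 1)) := by
      rw [ih (N + 1) (by omega), Finset.sum_range_succ', thetaCoeff_zero, zero_mul, add_zero]
    -- After shifting by two, the extra terms vanish: `j = 0` by its coefficient, `j = 1` because `a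
    -- * a⁻¹ - a⁻¹ * a = 0`, the top two by the cutoff.
    have s2 : ∑ j ∈ Finset.range N,
        thetaCoeff q (m + 1) (j + 2) * (a ^ (j + 1) - a⁻¹ ^ (j + 1)) =
        ∑ j ∈ Finset.range N, thetaCoeff q (m + 1) j * (a ^ j * a⁻¹ - a⁻¹ ^ j * a) := by
      have h : ∑ j ∈ Finset.range (N + 2), thetaCoeff q (m + 1) j * (a ^ j * a⁻¹ - a⁻¹ ^ j * a) =
          ∑ j ∈ Finset.range N,
            thetaCoeff q (m + 1) (j + 2) * (a ^ (j + 1) - a⁻¹ ^ (j + 1)) := by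
        rw [Finset.sum_range_succ', Finset.sum_range_succ', thetaCoeff_zero]
        simp only [zero_add, pow_one, mul_inv_cancel₀ ha, inv_mul_cancel₀ ha, sub_self, mul_zero,
          zero_mul, add_zero]
        refine Finset.sum_congr rfl fun j _ => ?_
        have : a * a⁻¹ = 1 := mul_inv_cancel₀ ha
        linear_combination thetaCoeff q (m + 1) (j + 2) * (a ^ (j + 1) - a⁻¹ ^ (j + 1)) * this
      rw [← h, Finset.sum_range_succ, Finset.sum_range_succ, thetaCoeff_of_lt q (by omega),
        thetaCoeff_of_lt q (by omega)]
      ring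
    rw [hL, Finset.sum_range_succ', thetaCoeff_zero, zero_mul, add_zero]
    have s3 : ∑ j ∈ Finset.range N,
        thetaCoeff q (m + 1 + 1) (j + 1) * (a ^ (j + 1) - a⁻¹ ^ (j + 1)) =
        (1 + q ^ (2 * (m + 1))) * ∑ j ∈ Finset.range N,
          thetaCoeff q (m + 1) (j + 1) * (a ^ (j + 1) - a⁻¹ ^ (j + 1))
        + q ^ (m + 1) * ((∑ j ∈ Finset.range N,
          thetaCoeff q (m + 1) j * (a ^ (j + 1) - a⁻¹ ^ (j + 1)))
        + ∑ j ∈ Finset.range N,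
          thetaCoeff q (m + 1) (j + 2) * (a ^ (j + 1) - a⁻¹ ^ (j + 1))) := by
      rw [← Finset.sum_add_distrib, Finset.mul_sum, Finset.mul_sum, ← Finset.sum_add_distrib]
      refine Finset.sum_congr rfl fun j _ => ?_
      rw [thetaCoeff_succ_succ hq (by omega)]
      ring
    have s4 : (∑ j ∈ Finset.range N,
          thetaCoeff q (m + 1) j * (a ^ (j + 1) - a⁻¹ ^ (j + 1)))
        + ∑ j ∈ Finset.range N, thetaCoeff q (m + 1) j * (a ^ j * a⁻¹ - a⁻¹ ^ j * a)
        = (a + a⁻¹) * F := by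
      rw [ih N (by omega), Finset.mul_sum, ← Finset.sum_add_distrib]
      refine Finset.sum_congr rfl fun j _ => ?_
      ring
    rw [s3, ← s1, s2, s4]
    ring

/-! ### Summation over the outer index -/

/-- The summand of a `₁φ₁` series which sums to `1`. -/
noncomputable def phiTerm (q : ℂ) (i k : ℕ) : ℂ :=
  (-1) ^ k * q ^ (k + 1).choose 2 * q ^ ((i + 1) * k) * qFactorial q q (i + k) * (1 - q ^ (i + 1))
    * (qFactorial q q k)⁻¹ * (qFactorial q q (k + 2 * (i + 1)))⁻¹

/-- The antidifference of `phiTerm q (i + 1) - phiTerm q i`. -/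
noncomputable def phiCert (q : ℂ) (i k : ℕ) : ℂ :=
  (-1) ^ k * q ^ (k + 1).choose 2 * q ^ ((i + 1) * k) * qFactorial q q (i + k) * (1 - q ^ k)
    * (1 - q ^ (i + 1) - q ^ k * q ^ (i + 1) * (1 - q * q ^ (2 * (i + 1))))
    * (qFactorial q q k)⁻¹ * (qFactorial q q (k + 2 * (i + 1) + 1))⁻¹

/-- A step in `i` is a difference in `k`, so the sum over `k` does not depend on `i` once the
certificate vanishes at `0` and at infinity. Stripped of common factors, it is a rational identity
in `q`, `q^k` and `q^(i+1)`. -/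
theorem phiTerm_succ_sub {q : ℂ} (hq : ‖q‖ < 1) (i k : ℕ) :
    phiTerm q (i + 1) k - phiTerm q i k = phiCert q i (k + 1) - phiCert q i k := by
  have h0 := qFactorial_self_ne_zero hq k
  have h1 := qFactorial_self_ne_zero hq (k + 2 * (i + 1))
  have o1 := one_sub_pow_succ_ne_zero hq (k + 2 * (i + 1))
  have o2 : 1 - q ^ (k + 2 * (i + 1) + 2) ≠ 0 := one_sub_pow_succ_ne_zero hq _
  have o3 := one_sub_pow_succ_ne_zero hq k
  have e1 : k + 2 * (i + 1 + 1) = k + 2 * (i + 1) + 1 + 1 := by ring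
  have e2 : k + 1 + 2 * (i + 1) + 1 = k + 2 * (i + 1) + 1 + 1 := by ring
  have e0 : k + 2 * (i + 1) + 1 + 1 = k + 2 * (i + 1) + 2 := rfl
  have e3 : i + 1 + k = i + k + 1 := by ring
  have e4 : i + (k + 1) = i + k + 1 := by ring
  simp only [phiTerm, phiCert]
  rw [e1, e2, e3, e4]
  simp only [qFactorial_self_succ q (k + 2 * (i + 1) + 1), qFactorial_self_succ q k,
    qFactorial_self_succ q (i + k), qFactorial_self_succ q (k + 2 * (i + 1)),
    choose_two_succ (k + 1)]
  generalize qFactorial q q k = S at *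
  generalize qFactorial q q (k + 2 * (i + 1)) = S at *
  generalize qFactorial q q (i + k) = S at *
  generalize (k + 1).choose 2 = c at *
  rw [e0]
  have e5 : (i + 1 + 1) * k = (i + 1) * k + k := by ring
  have e6 : (i + 1) * (k + 1) = (i + 1) * k + (i + 1) := by ring
  have e7 : i + k + 1 = i + 1 + k := by ring
  rw [e5, e6, e7]
  generalize (i + 1) * k = d at *
  generalize i + 1 = j at *
  simp only [pow_add, pow_mul', pow_one] at *
  generalize q ^ k = X at *
  generalize q ^ j = Y at *
  generalize q ^ c = Z at *
  generalize q ^ d = W at *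
  generalize (-1 : ℂ) ^ k = V at *
  field_simp
  ring

theorem norm_one_sub_pow_le {q : ℂ} (hq : ‖q‖ < 1) (k : ℕ) : ‖1 - q ^ k‖ ≤ 2 := by
  have h : ‖q ^ k‖ ≤ 1 := by
    rw [norm_pow]
    exact pow_le_one₀ (norm_nonneg _) hq.le
  have := norm_sub_le (1 : ℂ) (q ^ k)
  rw [norm_one] at this
  linarith

theorem summable_phiTerm {q : ℂ} (hq : ‖q‖ < 1) (i : ℕ) : Summable (phiTerm q i) := by
  obtain ⟨M, hM, hp⟩ := exists_bound_qFactorial_self hq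
  refine Summable.of_norm_bounded
    ((summable_pow_choose_succ_two (norm_nonneg q) hq).mul_right (1 * M * 2 * M * M)) fun k => ?_
  have h1 : ‖q‖ ^ ((i + 1) * k) ≤ 1 := pow_le_one₀ (norm_nonneg _) hq.le
  have h2 := norm_one_sub_pow_le hq (i + 1)
  have h3 := (hp (i + k)).1
  have h4 := (hp k).2
  have h5 := (hp (k + 2 * (i + 1))).2
  calc ‖phiTerm q i k‖ = ‖q‖ ^ (k + 1).choose 2 * (‖q‖ ^ ((i + 1) * k) * ‖qFactorial q q (i + k)‖
        * ‖1 - q ^ (i + 1)‖ * ‖(qFactorial q q k)⁻¹‖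
        * ‖(qFactorial q q (k + 2 * (i + 1)))⁻¹‖) := by
        simp only [phiTerm, norm_mul, norm_pow, norm_neg, norm_one, one_pow, one_mul, mul_assoc]
    _ ≤ _ := by gcongr

theorem tendsto_phiCert {q : ℂ} (hq : ‖q‖ < 1) (i : ℕ) :
    Tendsto (phiCert q i) atTop (𝓝 0) := by
  obtain ⟨M, hM, hp⟩ := exists_bound_qFactorial_self hq
  refine squeeze_zero_norm (a := fun k => ‖q‖ ^ (k + 1).choose 2 * (1 * M * 2 * 4 * M * M))
    (fun k => ?_) ?_
  · have h1 : ‖q‖ ^ ((i + 1) * k) ≤ 1 := pow_le_one₀ (norm_nonneg _) hq.le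
    have h2 := norm_one_sub_pow_le hq k
    have h3 := (hp (i + k)).1
    have h4 := (hp k).2
    have h5 := (hp (k + 2 * (i + 1) + 1)).2
    have h6 : ‖1 - q ^ (i + 1) - q ^ k * q ^ (i + 1) * (1 - q * q ^ (2 * (i + 1)))‖ ≤ 4 := by
      rw [← pow_add, ← pow_succ']
      calc _ ≤ ‖1 - q ^ (i + 1)‖ + ‖q ^ (k + (i + 1)) * (1 - q ^ (2 * (i + 1) + 1))‖ :=
            norm_sub_le _ _
        _ ≤ 2 + 1 * 2 := by
            rw [norm_mul, norm_pow]
            gcongr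
            · exact norm_one_sub_pow_le hq _
            · exact pow_le_one₀ (norm_nonneg _) hq.le
            · exact norm_one_sub_pow_le hq _
        _ = 4 := by norm_num
    calc ‖phiCert q i k‖ = ‖q‖ ^ (k + 1).choose 2 * (‖q‖ ^ ((i + 1) * k)
          * ‖qFactorial q q (i + k)‖ * ‖1 - q ^ k‖
          * ‖1 - q ^ (i + 1) - q ^ k * q ^ (i + 1) * (1 - q * q ^ (2 * (i + 1)))‖
          * ‖(qFactorial q q k)⁻¹‖ * ‖(qFactorial q q (k + 2 * (i + 1) + 1))⁻¹‖) := by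
          simp only [phiCert, norm_mul, norm_pow, norm_neg, norm_one, one_pow, one_mul, mul_assoc]
      _ ≤ _ := by gcongr
  · simpa using (summable_pow_choose_succ_two (norm_nonneg q) hq).tendsto_atTop_zero.mul_const
      (1 * M * 2 * 4 * M * M)

/-- Base case of the induction on `i`: here the series telescopes by itself. -/
theorem sum_range_phiTerm_zero {q : ℂ} (hq : ‖q‖ < 1) (K : ℕ) :
    ∑ k ∈ Finset.range K, phiTerm q 0 k =
      1 - (-1) ^ K * q ^ (K + 1).choose 2 * q ^ K * (1 - q) * (qFactorial q q (K + 1))⁻¹ := by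
  have hq1 : 1 - q ≠ 0 := by simpa using one_sub_pow_succ_ne_zero hq 0
  induction K with
  | zero => simp [qFactorial, hq1]
  | succ K ih =>
    have h0 := qFactorial_self_ne_zero hq K
    have o1 := one_sub_pow_succ_ne_zero hq K
    have o2 : 1 - q ^ (K + 2) ≠ 0 := one_sub_pow_succ_ne_zero hq _
    rw [Finset.sum_range_succ, ih, phiTerm]
    simp only [zero_add, one_mul, mul_one, qFactorial_self_succ q (K + 1),
      qFactorial_self_succ q K, choose_two_succ (K + 1)]
    generalize qFactorial q q K = S at *
    generalize (K + 1).choose 2 = c at *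
    simp only [pow_add, pow_one] at *
    generalize q ^ K = X at *
    generalize q ^ c = Z at *
    generalize (-1 : ℂ) ^ K = V at *
    field_simp
    ring

theorem tendsto_sum_range_phiTerm {q : ℂ} (hq : ‖q‖ < 1) (i : ℕ) :
    Tendsto (fun K => ∑ k ∈ Finset.range K, phiTerm q i k) atTop (𝓝 1) := by
  induction i with
  | zero =>
    obtain ⟨M, hM, hp⟩ := exists_bound_qFactorial_self hq
    have h : Tendsto (fun K : ℕ => (-1) ^ K * q ^ (K + 1).choose 2 * q ^ K * (1 - q)
        * (qFactorial q q (K + 1))⁻¹) atTop (𝓝 0) := by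
      refine squeeze_zero_norm (a := fun K => ‖q‖ ^ (K + 1).choose 2 * (1 * ‖1 - q‖ * M))
        (fun K => ?_) ?_
      · have h1 : ‖q‖ ^ K ≤ 1 := pow_le_one₀ (norm_nonneg _) hq.le
        have h2 := (hp (K + 1)).2
        calc _ = ‖q‖ ^ (K + 1).choose 2 * (‖q‖ ^ K * ‖1 - q‖ * ‖(qFactorial q q (K + 1))⁻¹‖) := by
              simp only [norm_mul, norm_pow, norm_neg, norm_one, one_pow, one_mul, mul_assoc]
          _ ≤ _ := by gcongr
      · simpa using (summable_pow_choose_succ_two (norm_nonneg q) hq).tendsto_atTop_zero.mul_const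
          (1 * ‖1 - q‖ * M)
    simpa [sum_range_phiTerm_zero hq] using h.const_sub 1
  | succ i ih =>
    have h : ∀ K, ∑ k ∈ Finset.range K, phiTerm q (i + 1) k =
        ∑ k ∈ Finset.range K, phiTerm q i k + phiCert q i K := by
      intro K
      have h0 : phiCert q i 0 = 0 := by simp [phiCert]
      rw [← sub_eq_iff_eq_add', ← Finset.sum_sub_distrib,
        Finset.sum_congr rfl fun k _ => phiTerm_succ_sub hq i k,
        Finset.sum_range_sub, h0, sub_zero]
    simp only [h]
    simpa using ih.add (tendsto_phiCert hq i)

theorem hasSum_phiTerm {q : ℂ} (hq : ‖q‖ < 1) (i : ℕ) : HasSum (phiTerm q i) 1 :=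
  (summable_phiTerm hq i).hasSum_iff_tendsto_nat.2 (tendsto_sum_range_phiTerm hq i)

/-! ### The double series -/

/-- The coefficient of `a ^ j - a⁻¹ ^ j` in `(a - 1)` times the `(m + 1)`-st summand. -/
noncomputable def doubleCoeff (q : ℂ) (m j : ℕ) : ℂ :=
  if j ≤ m + 1 then (-1) ^ (m + 1) * q ^ (m + 2).choose 2 * q ^ j.choose 2 * qFactorial q q m
    * (1 - q ^ j) * (qFactorial q q (m + 1 - j))⁻¹ * (qFactorial q q (m + 1 + j))⁻¹ else 0

/-- With `n = m + 1`, the last factor `1 - q^(2n) = (1 - q^n)(1 + q^n)` of `(q; q)_{2n}` cancels `1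
+ q^n` from `thetaCoeff` and the last factor of `(q; q)_n`. -/
theorem doubleCoeff_eq {q : ℂ} (hq : ‖q‖ < 1) (m j : ℕ) :
    doubleCoeff q m j = (-1) ^ (m + 1) * q ^ (m + 2).choose 2 * qFactorial q q (m + 1)
      / qFactorial q q (2 * (m + 1)) * thetaCoeff q (m + 1) j := by
  unfold doubleCoeff thetaCoeff
  split_ifs
  · have e : 2 * (m + 1) - 1 = 2 * m + 1 := by omega
    have e' : 2 * (m + 1) = 2 * m + 1 + 1 := by ring
    rw [e, e', qFactorial_self_succ q (2 * m + 1), qFactorial_self_succ q m]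
    have h1 := qFactorial_self_ne_zero hq (2 * m + 1)
    have h2 := qFactorial_self_ne_zero hq (m + 1 - j)
    have h3 := qFactorial_self_ne_zero hq (m + 1 + j)
    have h4 := one_sub_pow_succ_ne_zero hq (2 * m + 1)
    have h5 : q ^ (2 * m + 1 + 1) = (q ^ (m + 1)) ^ 2 := by ring
    rw [h5] at h4 ⊢
    generalize q ^ (m + 1) = X at *
    field_simp
    ring
  · simp

theorem hasSum_doubleCoeff {q : ℂ} (hq : ‖q‖ < 1) (i : ℕ) :
    HasSum (fun m => doubleCoeff q m (i + 1)) ((-1) ^ (i + 1) * q ^ (i + 1) ^ 2) := by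
  have hinj : Function.Injective (fun k : ℕ => i + k) := add_right_injective i
  rw [← hinj.hasSum_iff]
  · have h := (hasSum_phiTerm hq i).mul_left ((-1) ^ (i + 1) * q ^ (i + 1) ^ 2)
    rw [mul_one] at h
    rw [show ((fun m => doubleCoeff q m (i + 1)) ∘ fun k => i + k) =
      fun k => (-1) ^ (i + 1) * q ^ (i + 1) ^ 2 * phiTerm q i k from ?_]
    · exact h
    funext k
    have e1 : i + k + 1 - (i + 1) = k := by omega
    have e2 : i + k + 1 + (i + 1) = k + 2 * (i + 1) := by ring
    -- For triangular numbers, `T(k+i+1) = T(k) + T(i+1) + k(i+1)` and `T(i+1) + T(i) = (i+1)^2`;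
    -- the square is the theta exponent.
    have e3 : (i + k + 2).choose 2 + (i + 1).choose 2
        = (i + 1) ^ 2 + ((k + 1).choose 2 + (i + 1) * k) := by
      have hT : ∀ n : ℕ, 2 * (n + 1).choose 2 = n * (n + 1) := fun n => by
        induction n with
        | zero => rfl
        | succ n ih => rw [choose_two_succ, mul_add, ih]; ring
      have := hT (i + k + 1)
      have := hT i
      have := hT k
      nlinarith
    have e4 : q ^ (i + k + 2).choose 2 * q ^ (i + 1).choose 2
        = q ^ (i + 1) ^ 2 * (q ^ (k + 1).choose 2 * q ^ ((i + 1) * k)) := by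
      rw [← pow_add, e3, pow_add, pow_add]
    simp only [Function.comp_apply, doubleCoeff, phiTerm]
    rw [if_pos (by omega), e1, e2, mul_assoc _ (q ^ _) (q ^ _), e4]
    ring
  · intro m hm
    have : ¬ i + 1 ≤ m + 1 := fun h => hm ⟨m - i, by simp only; omega⟩
    exact if_neg this

theorem exists_norm_doubleCoeff_le {q : ℂ} (hq : ‖q‖ < 1) :
    ∃ K : ℝ, ∀ m j, ‖doubleCoeff q m j‖ ≤ K * (‖q‖ ^ (m + 1).choose 2 * ‖q‖ ^ j.choose 2) := by
  obtain ⟨M, hM, hp⟩ := exists_bound_qFactorial_self hq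
  refine ⟨M * 2 * M * M, fun m j => ?_⟩
  unfold doubleCoeff
  split_ifs
  · have h1 : ‖q‖ ^ (m + 2).choose 2 ≤ ‖q‖ ^ (m + 1).choose 2 :=
      pow_le_pow_of_le_one (norm_nonneg _) hq.le (by rw [choose_two_succ (m + 1)]; omega)
    have h2 := norm_one_sub_pow_le hq j
    have h3 := (hp m).1
    have h4 := (hp (m + 1 - j)).2
    have h5 := (hp (m + 1 + j)).2
    calc _ = ‖qFactorial q q m‖ * ‖1 - q ^ j‖ * ‖(qFactorial q q (m + 1 - j))⁻¹‖
          * ‖(qFactorial q q (m + 1 + j))⁻¹‖ * (‖q‖ ^ (m + 2).choose 2 * ‖q‖ ^ j.choose 2) := by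
          simp only [norm_mul, norm_pow, norm_neg, norm_one, one_pow, one_mul]
          ring
      _ ≤ _ := by gcongr
  · rw [norm_zero]
    positivity

/-- The bound on `doubleCoeff` separates `m` from `j`, so a product of two convergent series
dominates; this justifies exchanging the sums. -/
theorem summable_doubleCoeff_mul {q : ℂ} (hq : ‖q‖ < 1) (a : ℂ) :
    Summable fun p : ℕ × ℕ => doubleCoeff q p.1 p.2 * (a ^ p.2 - a⁻¹ ^ p.2) := by
  obtain ⟨K, hK⟩ := exists_norm_doubleCoeff_le hq
  have h1 := summable_pow_choose_succ_two (norm_nonneg q) hq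
  have h2 : Summable fun j : ℕ => ‖q‖ ^ j.choose 2 * (‖a‖ ^ j + ‖a⁻¹‖ ^ j) := by
    simpa only [mul_add] using (summable_pow_choose_two_mul_pow (norm_nonneg q) hq ‖a‖).add
      (summable_pow_choose_two_mul_pow (norm_nonneg q) hq ‖a⁻¹‖)
  have h3 := (h1.mul_of_nonneg h2 (fun _ => by positivity) (fun _ => by positivity)).mul_left K
  refine Summable.of_norm_bounded h3 fun p => ?_
  have h4 : ‖a ^ p.2 - a⁻¹ ^ p.2‖ ≤ ‖a‖ ^ p.2 + ‖a⁻¹‖ ^ p.2 := by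
    simpa only [norm_pow] using norm_sub_le (a ^ p.2) (a⁻¹ ^ p.2)
  calc _ = ‖doubleCoeff q p.1 p.2‖ * ‖a ^ p.2 - a⁻¹ ^ p.2‖ := norm_mul _ _
    _ ≤ K * (‖q‖ ^ (p.1 + 1).choose 2 * ‖q‖ ^ p.2.choose 2) * (‖a‖ ^ p.2 + ‖a⁻¹‖ ^ p.2) :=
      mul_le_mul (hK _ _) h4 (norm_nonneg _) ((norm_nonneg _).trans (hK _ _))
    _ = _ := by ring

/-! ### The two series of the identity -/

theorem leftTerm_succPNat (a x : ℂ) (m : ℕ) : leftTerm a x m.succPNat =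
    qFactorial (-a * x) x m * (qFactorial (-1 / a) x (m + 1) * qFactorial x x (m + 1))
      * x ^ (m + 2).choose 2 * (-1) ^ (m + 1) / qFactorial x x (2 * (m + 1)) := by
  have e : (m + 2).choose 2 = (m + 1) * (m + 1 + 1) / 2 := by
    rw [Nat.choose_two_right, mul_comm]
    rfl
  rw [leftTerm, qFactorial₂, e]
  rfl

theorem hasSum_sub_one_mul_leftTerm {a x : ℂ} (ha : a ≠ 0) (hx : ‖x‖ < 1) (m : ℕ) :
    HasSum (fun j => doubleCoeff x m j * (a ^ j - a⁻¹ ^ j))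
      ((a - 1) * leftTerm a x m.succPNat) := by
  have h : (a - 1) * leftTerm a x m.succPNat =
      ∑ j ∈ Finset.range (m + 2), doubleCoeff x m j * (a ^ j - a⁻¹ ^ j) := by
    have e1 : qFactorial (-1 / a) x (m + 1) = (1 + a⁻¹) * qFactorial (-a⁻¹ * x) x m := by
      rw [qFactorial, Finset.prod_range_succ', mul_comm, qFactorial]
      congr 1
      · simp [neg_div]
      · exact Finset.prod_congr rfl fun k _ => by ring
    have e2 := prod_eq_sum_thetaCoeff hx ha m (m + 2) (by omega)
    simp only [doubleCoeff_eq hx, mul_assoc]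
    simp only [← Finset.mul_sum]
    rw [leftTerm_succPNat, e1, ← e2]
    have e3 : (a - 1) * (1 + a⁻¹) = a - a⁻¹ := by
      field_simp
      ring
    rw [← e3]
    ring
  rw [h]
  refine hasSum_sum_of_ne_finset_zero fun j hj => ?_
  rw [doubleCoeff, if_neg (by simp at hj; omega), zero_mul]

theorem summable_leftTerm (a : ℂ) {x : ℂ} (hx : ‖x‖ < 1) : Summable (leftTerm a x) := by
  obtain ⟨M, hM, hp⟩ := exists_bound_qFactorial_self hx
  rw [← Equiv.pnatEquivNat.symm.summable_iff]
  refine Summable.of_norm_bounded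
    (((summable_nat_add_iff 1).2 (summable_pow_choose_succ_two (norm_nonneg x) hx)).mul_right
      (Real.exp (‖-a * x‖ * (1 - ‖x‖)⁻¹) * (Real.exp (‖-1 / a‖ * (1 - ‖x‖)⁻¹) * M) * M))
      fun m => ?_
  have h1 := norm_qFactorial_le hx (-a * x) m
  have h2 := norm_qFactorial_le hx (-1 / a) (m + 1)
  have h3 := (hp (m + 1)).1
  have h4 := (hp (2 * (m + 1))).2
  have e := leftTerm_succPNat a x m
  calc ‖leftTerm a x m.succPNat‖ = ‖x‖ ^ (m + 1 + 1).choose 2 * (‖qFactorial (-a * x) x m‖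
        * (‖qFactorial (-1 / a) x (m + 1)‖ * ‖qFactorial x x (m + 1)‖)
        * ‖(qFactorial x x (2 * (m + 1)))⁻¹‖) := by
        rw [e]
        simp only [div_eq_mul_inv, norm_mul, norm_pow, norm_neg, norm_one, one_pow]
        ring
    _ ≤ _ := by gcongr

theorem summable_neg_one_pow_mul_pow_sq {x : ℂ} (hx : ‖x‖ < 1) (b : ℂ) :
    Summable fun n : ℕ => (-1) ^ n * x ^ n ^ 2 * b ^ n := by
  refine Summable.of_norm_bounded
    (summable_pow_choose_two_mul_pow (norm_nonneg x) hx ‖b‖) fun n => ?_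
  have h : n.choose 2 ≤ n ^ 2 := Nat.choose_le_pow n 2
  have h' : ‖x‖ ^ n ^ 2 ≤ ‖x‖ ^ n.choose 2 := pow_le_pow_of_le_one (norm_nonneg _) hx.le h
  simp only [norm_mul, norm_pow, norm_neg, norm_one, one_pow, one_mul]
  gcongr

/-- Since `n^2 + 2n + 1 = (n+1)^2`, the second half is minus the term of index `n + 1` in the theta
series for `a⁻¹`. -/
theorem falseThetaTerm_eq (a x : ℂ) (n : ℕ) :
    falseThetaTerm a x n = (-1) ^ n * x ^ n ^ 2 * a ^ n
      - (-1) ^ (n + 1) * x ^ (n + 1) ^ 2 * a⁻¹ ^ (n + 1) := by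
  have h : a ^ (-(n : ℤ) - 1) = a⁻¹ ^ (n + 1) := by
    rw [inv_pow, ← zpow_natCast, ← zpow_neg]
    congr 1
    push_cast
    ring
  rw [falseThetaTerm, h]
  ring

theorem mainTheorem5 (a x : ℂ) (ha : a ≠ 0) (hx : ‖x‖ < 1) :
    Summable (leftTerm a x) ∧ Summable (falseThetaTerm a x) ∧
      1 + (a - 1) * ∑' n : ℕ+, leftTerm a x n = ∑' n : ℕ, falseThetaTerm a x n := by
  have hA := summable_neg_one_pow_mul_pow_sq hx a
  have hB := summable_neg_one_pow_mul_pow_sq hx a⁻¹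
  have hA' := (summable_nat_add_iff 1).2 hA
  have hB' := (summable_nat_add_iff 1).2 hB
  have hF : falseThetaTerm a x = fun n : ℕ => (-1) ^ n * x ^ n ^ 2 * a ^ n
      - (-1) ^ (n + 1) * x ^ (n + 1) ^ 2 * a⁻¹ ^ (n + 1) := funext (falseThetaTerm_eq a x)
  refine ⟨summable_leftTerm a hx, by rw [hF]; exact hA.sub hB', ?_⟩
  have hD := summable_doubleCoeff_mul hx a
  have hL : (a - 1) * ∑' n : ℕ+, leftTerm a x n =
      ∑' m, ∑' j, doubleCoeff x m j * (a ^ j - a⁻¹ ^ j) := by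
    rw [← tsum_mul_left, ← Equiv.pnatEquivNat.symm.tsum_eq]
    refine tsum_congr fun m => ?_
    rw [Equiv.pnatEquivNat_symm_apply, (hasSum_sub_one_mul_leftTerm ha hx m).tsum_eq]
  have hC : ∑' j, ∑' m, doubleCoeff x m j * (a ^ j - a⁻¹ ^ j) =
      ∑' i : ℕ, ((-1) ^ (i + 1) * x ^ (i + 1) ^ 2 * a ^ (i + 1)
        - (-1) ^ (i + 1) * x ^ (i + 1) ^ 2 * a⁻¹ ^ (i + 1)) := by
    have hS : Summable fun j => ∑' m, doubleCoeff x m j * (a ^ j - a⁻¹ ^ j) := hD.prod_symm.prod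
    rw [hS.tsum_eq_zero_add]
    simp only [pow_zero, sub_self, mul_zero, tsum_zero, zero_add]
    refine tsum_congr fun i => ?_
    rw [((hasSum_doubleCoeff hx i).mul_right _).tsum_eq, mul_sub]
  have hR : ∑' n : ℕ, falseThetaTerm a x n =
      ∑' n : ℕ, (-1) ^ n * x ^ n ^ 2 * a ^ n
        - ∑' n : ℕ, (-1) ^ (n + 1) * x ^ (n + 1) ^ 2 * a⁻¹ ^ (n + 1) := by
    rw [hF]
    exact hA.tsum_sub hB'
  have hR' := hA'.tsum_sub hB'
  -- The term split off at `n = 0` is the isolated `1` on the left-hand side.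
  have hA0 := hA.tsum_eq_zero_add
  have hT : ∑' m, ∑' j, doubleCoeff x m j * (a ^ j - a⁻¹ ^ j) =
      ∑' j, ∑' m, doubleCoeff x m j * (a ^ j - a⁻¹ ^ j) :=
    (Summable.tsum_comm (f := fun m j => doubleCoeff x m j * (a ^ j - a⁻¹ ^ j)) hD).symm
  rw [hL, hT, hC, hR', hR, hA0]
  simp only [zero_pow two_ne_zero, pow_zero, mul_one]
  ring
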